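/- Let $X$ and $Y$ be real Banach spaces with duals $X^*$ and $Y^*$, let $f\colon X\to\,]-\infty,+\infty]$ and $g\colon Y\to\,]-\infty,+\infty]$ be convex functions, and let $T\colon X\to Y$ be a bounded linear operator with adjoint $T^*\colon Y^*\to X^*$, $\langle T^*y^*,x\rangle=\langle y^*,Tx\rangle$. For a function $h$ with values in $]-\infty,+\infty]$ write $\operatorname{dom}h=h^{-1}(\mathbb R)$ and let $\operatorname{cont}h$ be the set of points at which $h$ is finite and continuous. The subdifferential of $h\colon X\to\,]-\infty,+\infty]$ at $x\in\operatorname{dom}h$ is $$\partial h(x)=\{x^*\in X^*:\ \langle x^*,y-x\rangle\le h(y)-h(x)\ \text{for all } y\in X\},$$ and $\partial h(x)=\varnothing$ if $x\notin\operatorname{dom}h$ (likewise on $Y$). Then at every point $x\in X$ $$\partial(f+g\circ T)(x)\supseteq\partial f(x)+T^*\bigl(\partial g(Tx)\bigr).$$ If moreover either $$\bigcup_{\lambda>0}\lambda\,[\operatorname{dom}g-T\operatorname{dom}f]=Y\quad\text{and both } f \text{ and } g \text{ are lower semicontinuous,}$$ or $$\operatorname{cont}g\cap T\operatorname{dom}f\neq\varnothing,$$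 then equality holds at every point $x\in X$. -/

import Mathlib

open Set Topology
open scoped Pointwise

/-- The domain `dom f = f⁻¹(ℝ)` of an extended real valued function: the points where the value
is finite. -/
def effDom {X : Type*} (f : X → EReal) : Set X :=
  f ⁻¹' Set.range (fun r : ℝ => (r : EReal))

/-- A convex function `f : X → ]-∞, +∞]`: the value `-∞` is not taken, and the convexity
inequality holds for all points of the domain. The function `+∞` is allowed. -/
structure IsConvexFun {X : Type*} [AddCommGroup X] [Module ℝ X] (f : X → EReal) : Prop where
  ne_bot : ∀ x, f x ≠ ⊥
  convex : ∀ x ∈ effDom f, ∀ y ∈ effDom f, ∀ l : ℝ, 0 ≤ l → l ≤ 1 →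
    f (l • x + (1 - l) • y) ≤ (l : EReal) * f x + ((1 - l : ℝ) : EReal) * f y

/-- The set `cont f` of the points at which `f` is finite and continuous. -/
def contSet {X : Type*} [TopologicalSpace X] (f : X → EReal) : Set X :=
  {x | x ∈ effDom f ∧ ContinuousAt f x}

/-- The subdifferential `∂f(x)`: all continuous linear functionals `x'` with
`⟨x', y - x⟩ ≤ f y - f x` for every `y`. It is empty at the points outside the domain. -/
def subdifferential {X : Type*} [NormedAddCommGroup X] [NormedSpace ℝ X]
    (f : X → EReal) (x : X) : Set (StrongDual ℝ X) :=
  {x' | x ∈ effDom f ∧ ∀ y : X, ((x' (y - x) : ℝ) : EReal) ≤ f y - f x}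

/-- The adjoint `T* : Y* → X*` of a bounded linear map `T : X → Y`,
`⟨T* y', x⟩ = ⟨y', T x⟩`. -/
def dualAdjoint {X Y : Type*} [NormedAddCommGroup X] [NormedSpace ℝ X]
    [NormedAddCommGroup Y] [NormedSpace ℝ Y] (T : X →L[ℝ] Y) :
    StrongDual ℝ Y →ₗ[ℝ] StrongDual ℝ X where
  toFun y' := y'.comp T
  map_add' _ _ := rfl
  map_smul' _ _ := rfl

/-- The first Fenchel constraint qualification: `⋃_{r > 0} r (dom g - T dom f) = Y`, and both
functions are lower semicontinuous. -/
def FenchelCoreCondition {X Y : Type*} [NormedAddCommGroup X] [NormedSpace ℝ X]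
    [NormedAddCommGroup Y] [NormedSpace ℝ Y]
    (f : X → EReal) (g : Y → EReal) (T : X →L[ℝ] Y) : Prop :=
  (⋃ (r : ℝ) (_ : 0 < r), r • (effDom g - T '' effDom f)) = Set.univ ∧
    LowerSemicontinuous f ∧ LowerSemicontinuous g

/-- The second Fenchel constraint qualification: `g` is finite and continuous at some point of
`T dom f`. -/
def FenchelContinuityCondition {X Y : Type*} [NormedAddCommGroup X] [NormedSpace ℝ X]
    [NormedAddCommGroup Y] [NormedSpace ℝ Y]
    (f : X → EReal) (g : Y → EReal) (T : X →L[ℝ] Y) : Prop :=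
  (contSet g ∩ T '' effDom f).Nonempty

/-! The inclusion `⊇` is the sum of two subgradient inequalities. For `⊆`, subtracting `x'` and a
constant from `f + g ∘ T` gives a sum that is nonnegative on its domain, so the infimum over `y - T
z = u` is a convex function of `u`, nonnegative at `0`. If it is bounded above near `0`, Hahn-Banach
gives a linear minorant `y'`, and `x' = (x' - T* y') + T* y'` is the decomposition
(`exists_dual_le_of_bounded_value`). Each qualification gives the bound. Continuity of `g` does so
directly; the core condition needs Baire's theorem and an open mapping argument on bounded pieces of
sublevel sets (`exists_image_mem_nhds_zero_of_absorbing`). -/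

/-! ### Passage from extended real to real values. -/

section ExtendedReal

variable {X : Type*} {f : X → EReal}

lemma mem_effDom_iff {x : X} : x ∈ effDom f ↔ f x ≠ ⊥ ∧ f x ≠ ⊤ := by
  constructor
  · rintro ⟨r, hr⟩
    simp [← hr]
  · rintro ⟨hb, ht⟩
    exact ⟨(f x).toReal, EReal.coe_toReal ht hb⟩

lemma coe_toReal_of_mem_effDom {x : X} (hx : x ∈ effDom f) : ((f x).toReal : EReal) = f x :=
  EReal.coe_toReal (mem_effDom_iff.1 hx).2 (mem_effDom_iff.1 hx).1

lemma mem_effDom_of_le_coe {x : X} {c : ℝ} (hb : f x ≠ ⊥) (h : f x ≤ c) : x ∈ effDom f :=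
  mem_effDom_iff.2 ⟨hb, (h.trans_lt (EReal.coe_lt_top c)).ne⟩

lemma le_coe_iff_mem_effDom_and_toReal_le {x : X} {c : ℝ} (hb : f x ≠ ⊥) :
    f x ≤ c ↔ x ∈ effDom f ∧ (f x).toReal ≤ c := by
  constructor
  · intro h
    have hx := mem_effDom_of_le_coe hb h
    refine ⟨hx, ?_⟩
    rwa [← coe_toReal_of_mem_effDom hx, EReal.coe_le_coe_iff] at h
  · rintro ⟨hx, h⟩
    rwa [← coe_toReal_of_mem_effDom hx, EReal.coe_le_coe_iff]

lemma effDom_add {g : X → EReal} (hf : ∀ x, f x ≠ ⊥) (hg : ∀ x, g x ≠ ⊥) :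
    effDom (fun x => f x + g x) = effDom f ∩ effDom g := by
  ext x
  simp only [mem_inter_iff, mem_effDom_iff, ne_eq, EReal.add_eq_bot_iff]
  constructor
  · rintro ⟨-, h⟩
    refine ⟨⟨hf x, fun h' => h ?_⟩, hg x, fun h' => h ?_⟩
    · rw [h', EReal.top_add_of_ne_bot (hg x)]
    · rw [h', EReal.add_top_of_ne_bot (hf x)]
  · rintro ⟨⟨h1, h2⟩, h3, h4⟩
    exact ⟨by tauto, EReal.add_ne_top h2 h4⟩

variable [AddCommGroup X] [Module ℝ X]

lemma IsConvexFun.convexOn_toReal (hf : IsConvexFun f) :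
    ConvexOn ℝ (effDom f) fun x => (f x).toReal := by
  have key : ∀ x ∈ effDom f, ∀ y ∈ effDom f, ∀ a b : ℝ, 0 ≤ a → 0 ≤ b → a + b = 1 →
      f (a • x + b • y) ≤ ((a * (f x).toReal + b * (f y).toReal : ℝ) : EReal) := by
    intro x hx y hy a b ha hb hab
    obtain rfl : b = 1 - a := by linarith
    have h := hf.convex x hx y hy a ha (by linarith)
    rwa [← coe_toReal_of_mem_effDom hx, ← coe_toReal_of_mem_effDom hy, ← EReal.coe_mul,
      ← EReal.coe_mul, ← EReal.coe_add] at h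
  refine ⟨fun x hx y hy a b ha hb hab => ?_, fun x hx y hy a b ha hb hab => ?_⟩
  · exact mem_effDom_of_le_coe (hf.ne_bot _) (key x hx y hy a b ha hb hab)
  · exact ((le_coe_iff_mem_effDom_and_toReal_le (hf.ne_bot _)).1 (key x hx y hy a b ha hb hab)).2

lemma IsConvexFun.convex_setOf_le (hf : IsConvexFun f) (c : ℝ) : Convex ℝ {x | f x ≤ c} := by
  have h : {x | f x ≤ c} = {x ∈ effDom f | (f x).toReal ≤ c} :=
    Set.ext fun x => le_coe_iff_mem_effDom_and_toReal_le (hf.ne_bot x)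
  rw [h]
  exact hf.convexOn_toReal.convex_le c

end ExtendedReal

lemma mem_subdifferential_iff {X : Type*} [NormedAddCommGroup X] [NormedSpace ℝ X]
    {f : X → EReal} (hf : ∀ x, f x ≠ ⊥) {x : X} {x' : StrongDual ℝ X} :
    x' ∈ subdifferential f x ↔
      x ∈ effDom f ∧ ∀ y ∈ effDom f, x' (y - x) ≤ (f y).toReal - (f x).toReal := by
  refine and_congr_right fun hx => forall_congr' fun y => ?_
  by_cases hy : y ∈ effDom f
  · rw [← coe_toReal_of_mem_effDom hx, ← coe_toReal_of_mem_effDom hy, ← EReal.coe_sub,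
      EReal.coe_le_coe_iff]
    simp [hy]
  · have hy' : f y = ⊤ := by
      by_contra h
      exact hy (mem_effDom_iff.2 ⟨hf y, h⟩)
    rw [← coe_toReal_of_mem_effDom hx, hy', EReal.top_sub_coe]
    simp [hy]

/-! ### Hahn-Banach separation. -/

section Separation

variable {X Y : Type*} [AddCommGroup X] [Module ℝ X] [NormedAddCommGroup Y] [NormedSpace ℝ Y]

/-- If the value function `u ↦ inf {φ z + γ y | y - T z = u}` of two convex functions is
nonnegative at `0` and bounded above near `0`, then it has a continuous linear minorant. -/
theorem exists_dual_le_of_bounded_value {D : Set X} {E : Set Y} {φ : X → ℝ} {γ : Y → ℝ}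
    (hφ : ConvexOn ℝ D φ) (hγ : ConvexOn ℝ E γ) (T : X →ₗ[ℝ] Y)
    (hpos : ∀ z ∈ D, T z ∈ E → 0 ≤ φ z + γ (T z)) {M : ℝ}
    (hM : ∀ᶠ u in 𝓝 (0 : Y), ∃ z ∈ D, ∃ y ∈ E, y - T z = u ∧ φ z + γ y ≤ M) :
    ∃ l : StrongDual ℝ Y, ∀ z ∈ D, ∀ y ∈ E, l (y - T z) ≤ φ z + γ y := by
  -- The strict epigraph of the value function.
  set C : Set (Y × ℝ) := {p | ∃ z ∈ D, ∃ y ∈ E, y - T z = p.1 ∧ φ z + γ y < p.2} with hC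
  have hconv : Convex ℝ C := by
    rintro ⟨_, r⟩ ⟨z, hz, y, hy, rfl, hr⟩ ⟨_, s⟩ ⟨w, hw, v, hv, rfl, hs⟩ a b ha hb hab
    refine ⟨a • z + b • w, hφ.1 hz hw ha hb hab, a • y + b • v, hγ.1 hy hv ha hb hab, ?_, ?_⟩
    · simp only [map_add, map_smul, Prod.mk_add_mk, Prod.smul_mk]
      module
    · have h1 := hφ.2 hz hw ha hb hab
      have h2 := hγ.2 hy hv ha hb hab
      simp only [smul_eq_mul, Prod.smul_mk, Prod.mk_add_mk] at *
      rcases ha.eq_or_lt with rfl | ha'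
      · obtain rfl : b = 1 := by linarith
        linarith
      · nlinarith [mul_lt_mul_of_pos_left hr ha', mul_le_mul_of_nonneg_left hs.le hb]
  have h0 : (0 : Y × ℝ) ∉ interior C := by
    intro h
    obtain ⟨z, hz, y, hy, hyz, hlt⟩ := interior_subset h
    obtain rfl : y = T z := sub_eq_zero.1 hyz
    exact absurd hlt (not_lt.2 (hpos z hz hy))
  -- The height exceeds `M` and is positive; the sign yields `F (0, 1) < 0`, so the hyperplane is
  -- not vertical.
  have hint : ((0 : Y), |M| + 1) ∈ interior C := by
    rw [mem_interior_iff_mem_nhds, nhds_prod_eq]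
    have hr : ∀ᶠ r in 𝓝 (|M| + 1), M < r := lt_mem_nhds (by linarith [le_abs_self M])
    filter_upwards [hM.prod_mk hr] with p hp
    obtain ⟨⟨z, hz, y, hy, h, hle⟩, hlt⟩ := hp
    exact ⟨z, hz, y, hy, h, hle.trans_lt hlt⟩
  obtain ⟨F, hF⟩ := geometric_hahn_banach_open_point hconv.interior isOpen_interior h0
  rw [map_zero] at hF
  have hF' : ∀ p ∈ C, F p ≤ 0 := by
    intro p hp
    have hp' : p ∈ closure (interior C) := by
      rw [hconv.closure_interior_eq_closure_of_nonempty_interior ⟨_, hint⟩]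
      exact subset_closure hp
    exact closure_minimal (fun q hq => (hF q hq).le)
      (isClosed_le F.continuous continuous_const) hp'
  have hsplit : ∀ (u : Y) (r : ℝ), F (u, r) = F (u, 0) + r * F (0, 1) := by
    intro u r
    rw [← smul_eq_mul, ← map_smul, ← map_add]
    simp
  have hneg : F (0, 1) < 0 := by
    have h := hF _ hint
    rw [hsplit, ← Prod.zero_eq_mk, map_zero, zero_add] at h
    exact (pos_iff_neg_of_mul_neg h).1 (by positivity)
  refine ⟨(-F (0, 1))⁻¹ • F.comp (ContinuousLinearMap.inl ℝ Y ℝ), fun z hz y hy => ?_⟩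
  refine le_of_forall_gt_imp_ge_of_dense fun r hr => ?_
  have h := hF' (y - T z, r) ⟨z, hz, y, hy, rfl, hr⟩
  rw [hsplit] at h
  change (-F (0, 1))⁻¹ * F (y - T z, 0) ≤ r
  rw [inv_mul_le_iff₀ (neg_pos.2 hneg)]
  linarith

end Separation

/-! ### Baire category and open mapping for convex sets. -/

section OpenMapping

variable {V Y : Type*} [NormedAddCommGroup V] [NormedSpace ℝ V] [CompleteSpace V]
  [NormedAddCommGroup Y] [NormedSpace ℝ Y]

/-- The sum of a series of points of a closed bounded convex set with weights `2⁻¹, 2⁻², …`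
belongs to the set. -/
lemma exists_hasSum_geometric_mem {A : Set V} (hconv : Convex ℝ A) (hcl : IsClosed A)
    (hbd : Bornology.IsBounded A) {a : ℕ → V} (ha : ∀ n, a n ∈ A) :
    ∃ s ∈ A, HasSum (fun n => ((1 / 2 : ℝ) ^ (n + 1)) • a n) s := by
  obtain ⟨R, hR⟩ := hbd.exists_norm_le
  have hw : HasSum (fun n : ℕ => (1 / 2 : ℝ) ^ (n + 1)) 1 := by
    simpa [pow_succ] using hasSum_geometric_two.mul_right (1 / 2 : ℝ)
  have hsum : Summable fun n => ((1 / 2 : ℝ) ^ (n + 1)) • a n := by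
    refine Summable.of_norm_bounded (hw.summable.mul_right R) fun n => ?_
    rw [norm_smul, Real.norm_of_nonneg (by positivity)]
    gcongr
    exact hR _ (ha n)
  refine ⟨_, ?_, hsum.hasSum⟩
  -- The missing weight `2⁻ⁿ` is put on `a 0`, which makes the partial sum a convex combination.
  have hfin : ∀ n : ℕ, (1 / 2 : ℝ) ^ n • a 0 +
      ∑ i ∈ Finset.range n, ((1 / 2 : ℝ) ^ (i + 1)) • a i ∈ A := by
    intro n
    have hs : ∀ n : ℕ, (1 / 2 : ℝ) ^ n + ∑ i ∈ Finset.range n, (1 / 2 : ℝ) ^ (i + 1) = 1 := by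
      intro n
      induction n with
      | zero => simp
      | succ n ih =>
        rw [Finset.sum_range_succ, pow_succ]
        linarith
    have h := hconv.sum_mem (t := Finset.range (n + 1))
      (w := fun i => if i = n then (1 / 2 : ℝ) ^ n else (1 / 2) ^ (i + 1))
      (z := fun i => if i = n then a 0 else a i) (fun i _ => by split_ifs <;> positivity) ?_
      (fun i _ => by split_ifs <;> exact ha _)
    · rw [Finset.sum_range_succ, add_comm] at h
      simp only [if_true] at h
      convert h using 2
      refine Finset.sum_congr rfl fun i hi => ?_
      rw [if_neg (Finset.mem_range.1 hi).ne, if_neg (Finset.mem_range.1 hi).ne]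
    · refine Eq.trans ?_ (hs n)
      rw [Finset.sum_range_succ, add_comm]
      simp only [if_true]
      congr 1
      refine Finset.sum_congr rfl fun i hi => ?_
      rw [if_neg (Finset.mem_range.1 hi).ne]
  refine hcl.mem_of_tendsto (b := Filter.atTop) ?_ (Filter.Eventually.of_forall hfin)
  have h0 : Filter.Tendsto (fun n : ℕ => (1 / 2 : ℝ) ^ n • a 0) Filter.atTop (𝓝 0) := by
    simpa using (tendsto_pow_atTop_nhds_zero_of_lt_one (r := (1 / 2 : ℝ))
      (by norm_num) (by norm_num)).smul_const (a 0)
  simpa using h0.add hsum.hasSum.tendsto_sum_nat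

/-- A continuous linear image of a closed bounded convex subset of a Banach space is a
neighbourhood of `0` as soon as its closure is one. -/
theorem Convex.image_mem_nhds_zero_of_closure {A : Set V} (hconv : Convex ℝ A)
    (hcl : IsClosed A) (hbd : Bornology.IsBounded A) (L : V →L[ℝ] Y)
    (h : closure (L '' A) ∈ 𝓝 0) : L '' A ∈ 𝓝 0 := by
  obtain ⟨r, hr, hball⟩ := Metric.mem_nhds_iff.1 h
  have step : ∀ u : Y, ‖u‖ < r / 2 → ∃ a ∈ A, ‖(2 : ℝ) • u - L a‖ < r / 2 := by
    intro u hu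
    have hu' : (2 : ℝ) • u ∈ closure (L '' A) := by
      apply hball
      rw [mem_ball_zero_iff, norm_smul, Real.norm_of_nonneg zero_le_two]
      linarith
    obtain ⟨_, ⟨a, ha, rfl⟩, hd⟩ := Metric.mem_closure_iff.1 hu' (r / 2) (by positivity)
    exact ⟨a, ha, by rwa [← dist_eq_norm]⟩
  choose! p hpA hp using step
  filter_upwards [Metric.ball_mem_nhds (0 : Y) (half_pos hr)] with u hu
  rw [mem_ball_zero_iff] at hu
  -- Rescaled remainders: `2⁻ⁿ v n` is what is left of `u` after `n` terms, and `v n` stays in the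
  -- ball of radius `r / 2`.
  let v : ℕ → Y := fun n => Nat.rec u (fun _ w => (2 : ℝ) • w - L (p w)) n
  have hv : ∀ n, ‖v n‖ < r / 2 := fun n => Nat.rec hu (fun n ih => hp _ ih) n
  obtain ⟨s, hsA, hs⟩ := exists_hasSum_geometric_mem hconv hcl hbd (a := fun n => p (v n))
    fun n => hpA _ (hv n)
  refine ⟨s, hsA, ?_⟩
  have hpart : ∀ n, ∑ i ∈ Finset.range n, L ((1 / 2 : ℝ) ^ (i + 1) • p (v i)) =
      u - (1 / 2 : ℝ) ^ n • v n := by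
    intro n
    induction n with
    | zero => simp [v]
    | succ n ih =>
      have hvn : v (n + 1) = (2 : ℝ) • v n - L (p (v n)) := rfl
      rw [Finset.sum_range_succ, ih, hvn, map_smul, pow_succ]
      module
  have h0 : Filter.Tendsto (fun n : ℕ => (1 / 2 : ℝ) ^ n • v n) Filter.atTop (𝓝 0) := by
    refine squeeze_zero_norm (a := fun n => (1 / 2 : ℝ) ^ n * (r / 2)) (fun n => ?_) ?_
    · rw [norm_smul, Real.norm_of_nonneg (by positivity)]
      gcongr
      exact (hv n).le
    · simpa using (tendsto_pow_atTop_nhds_zero_of_lt_one (r := (1 / 2 : ℝ))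
        (by norm_num) (by norm_num)).mul_const (r / 2)
  refine tendsto_nhds_unique (L.hasSum hs).tendsto_sum_nat ?_
  simp only [hpart]
  simpa using tendsto_const_nhds.sub h0

/-- If the positive multiples of the images of an increasing sequence of closed bounded convex
sets cover a Banach space, then one of these images is a neighbourhood of `0`. -/
theorem exists_image_mem_nhds_zero_of_absorbing [CompleteSpace Y] {A : ℕ → Set V}
    (hmono : Monotone A) (hconv : ∀ n, Convex ℝ (A n)) (hcl : ∀ n, IsClosed (A n))
    (hbd : ∀ n, Bornology.IsBounded (A n)) (L : V →L[ℝ] Y)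
    (habs : ∀ u : Y, ∃ r : ℝ, 0 < r ∧ ∃ n, u ∈ r • (L '' A n)) :
    ∃ n, L '' A n ∈ 𝓝 0 := by
  have hmonoL : Monotone fun n => L '' A n := fun m n hmn => image_mono (hmono hmn)
  obtain ⟨n₀, h0⟩ : ∃ n, (0 : Y) ∈ L '' A n := by
    obtain ⟨r, hr, n, h⟩ := habs 0
    exact ⟨n, (zero_mem_smul_set_iff hr.ne').1 h⟩
  have hcover : ⋃ n : ℕ, ((n : ℝ) + 1) • closure (L '' A n) = univ := by
    refine eq_univ_of_forall fun u => ?_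
    obtain ⟨r, hr, n, a, ha, rfl⟩ := habs u
    obtain ⟨k, hk⟩ := exists_nat_ge r
    set N := max k (max n n₀)
    -- Since `0` is in the image of `A N`, that image contains the shrunken point `(r / (N + 1)) •
    -- a`.
    have hN : r ≤ (N : ℝ) + 1 := by
      have : (k : ℝ) ≤ N := by exact_mod_cast le_max_left _ _
      linarith
    have haN : a ∈ L '' A N := hmonoL (le_max_of_le_right (le_max_left _ _)) ha
    have h0N : 0 ∈ L '' A N := hmonoL (le_max_of_le_right (le_max_right _ _)) h0
    refine mem_iUnion.2 ⟨N, (r / (N + 1)) • a, subset_closure ?_, ?_⟩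
    · exact ((hconv N).linear_image (L : V →ₗ[ℝ] Y)).smul_mem_of_zero_mem h0N haN
        ⟨by positivity, div_le_one_of_le₀ hN (by positivity)⟩
    · change ((N : ℝ) + 1) • (r / (N + 1)) • a = r • a
      rw [smul_smul, mul_div_cancel₀ _ (by positivity)]
  obtain ⟨n, hn⟩ := nonempty_interior_of_iUnion_of_closed
    (fun n : ℕ => isClosed_closure.smul_of_ne_zero (c := (n : ℝ) + 1) (by positivity)) hcover
  rw [interior_smul₀ (by positivity)] at hn
  obtain ⟨u, hu⟩ := smul_set_nonempty.1 hn
  -- Baire gives an interior point `u`, not necessarily `0`; absorbing `-u` places `0` on the open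
  -- segment from `u` to `a`.
  obtain ⟨r, hr, m, a, ha, hra⟩ := habs (-u)
  set N := max n m
  refine ⟨N, (hconv N).image_mem_nhds_zero_of_closure (hcl N) (hbd N) L ?_⟩
  rw [← mem_interior_iff_mem_nhds]
  have hLN : Convex ℝ (closure (L '' A N)) :=
    ((hconv N).linear_image (L : V →ₗ[ℝ] Y)).closure
  refine hLN.openSegment_interior_closure_subset_interior
    (interior_mono (closure_mono (hmonoL (le_max_left _ _))) hu)
    (subset_closure (subset_closure (hmonoL (le_max_right _ _) ha))) ?_
  refine ⟨1 / (1 + r), r / (1 + r), by positivity, by positivity, by field_simp, ?_⟩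
  have hra' : r • a = -u := hra
  rw [div_eq_inv_mul, div_eq_inv_mul, mul_smul, mul_smul, hra']
  simp

end OpenMapping

/-! ### Both qualifications bound the value function near `0`. -/

section Qualification

variable {X Y : Type*} [NormedAddCommGroup X] [NormedSpace ℝ X]
  [NormedAddCommGroup Y] [NormedSpace ℝ Y] {f : X → EReal} {g : Y → EReal} {T : X →L[ℝ] Y}

/-- Lower semicontinuity closes the sublevel sets; cutting them with balls makes them bounded, and
the core condition says that their differences absorb `Y`. -/
theorem FenchelCoreCondition.exists_bound [CompleteSpace X] [CompleteSpace Y]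
    (hf : IsConvexFun f) (hg : IsConvexFun g) (h : FenchelCoreCondition f g T) :
    ∃ M : ℝ, ∀ᶠ u in 𝓝 (0 : Y), ∃ z y, y - T z = u ∧ ‖z‖ ≤ M ∧ f z ≤ M ∧ g y ≤ M := by
  obtain ⟨hun, hfl, hgl⟩ := h
  let A : ℕ → Set (X × Y) := fun n =>
    (Metric.closedBall 0 n ∩ {z | f z ≤ ((n : ℝ) : EReal)}) ×ˢ
      (Metric.closedBall 0 n ∩ {y | g y ≤ ((n : ℝ) : EReal)})
  let L : X × Y →L[ℝ] Y := ContinuousLinearMap.snd ℝ X Y - T.comp (ContinuousLinearMap.fst ℝ X Y)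
  suffices h : ∃ n, L '' A n ∈ 𝓝 0 by
    obtain ⟨n, hn⟩ := h
    refine ⟨n, Filter.mem_of_superset hn ?_⟩
    rintro _ ⟨⟨z, y⟩, ⟨⟨hz, hfz⟩, -, hgy⟩, rfl⟩
    exact ⟨z, y, rfl, mem_closedBall_zero_iff.1 hz, hfz, hgy⟩
  refine exists_image_mem_nhds_zero_of_absorbing ?_ ?_ ?_ ?_ L ?_
  · intro m n hmn
    have hmn' : (m : ℝ) ≤ n := by exact_mod_cast hmn
    have hmn'' : ((m : ℝ) : EReal) ≤ ((n : ℝ) : EReal) := EReal.coe_le_coe_iff.2 hmn'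
    exact prod_mono
      (inter_subset_inter (Metric.closedBall_subset_closedBall hmn') fun z hz => le_trans hz hmn'')
      (inter_subset_inter (Metric.closedBall_subset_closedBall hmn') fun z hz => le_trans hz hmn'')
  · exact fun n => ((convex_closedBall _ _).inter (hf.convex_setOf_le n)).prod
      ((convex_closedBall _ _).inter (hg.convex_setOf_le n))
  · exact fun n => (Metric.isClosed_closedBall.inter (hfl.isClosed_preimage _)).prod
      (Metric.isClosed_closedBall.inter (hgl.isClosed_preimage _))
  · exact fun n => (Metric.isBounded_closedBall.subset inter_subset_left).prod
      (Metric.isBounded_closedBall.subset inter_subset_left)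
  · intro u
    have hu : u ∈ ⋃ (r : ℝ) (_ : 0 < r), r • (effDom g - T '' effDom f) := hun ▸ mem_univ u
    simp only [mem_iUnion] at hu
    obtain ⟨r, hr, v, ⟨y, hy, _, ⟨z, hz, rfl⟩, rfl⟩, rfl⟩ := hu
    obtain ⟨n, hn⟩ := exists_nat_ge (max (max ‖z‖ (f z).toReal) (max ‖y‖ (g y).toReal))
    simp only [max_le_iff] at hn
    refine ⟨r, hr, n, _, ⟨(z, y), ⟨⟨?_, ?_⟩, ?_, ?_⟩, rfl⟩, rfl⟩
    · exact mem_closedBall_zero_iff.2 hn.1.1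
    · exact (le_coe_iff_mem_effDom_and_toReal_le (hf.ne_bot z)).2 ⟨hz, hn.1.2⟩
    · exact mem_closedBall_zero_iff.2 hn.2.1
    · exact (le_coe_iff_mem_effDom_and_toReal_le (hg.ne_bot y)).2 ⟨hy, hn.2.2⟩

/-- Keep `z` fixed and let `y = u + T z` vary, where continuity bounds `g`. -/
theorem FenchelContinuityCondition.exists_bound (h : FenchelContinuityCondition f g T) :
    ∃ M : ℝ, ∀ᶠ u in 𝓝 (0 : Y), ∃ z y, y - T z = u ∧ ‖z‖ ≤ M ∧ f z ≤ M ∧ g y ≤ M := by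
  obtain ⟨_, ⟨hdom, hcont⟩, z, hz, rfl⟩ := h
  set M := max (max ‖z‖ (f z).toReal) ((g (T z)).toReal + 1)
  have hlt : g (T z) < M := by
    rw [← coe_toReal_of_mem_effDom hdom, EReal.coe_lt_coe_iff]
    exact (lt_add_one _).trans_le (le_max_right _ _)
  have ht : Filter.Tendsto (fun u => u + T z) (𝓝 0) (𝓝 (T z)) := by
    have hc : Continuous fun u : Y => u + T z := by fun_prop
    simpa using hc.tendsto 0
  refine ⟨M, ?_⟩
  filter_upwards [ht.eventually (hcont.eventually_lt_const hlt)] with u hu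
  refine ⟨z, u + T z, by abel, (le_max_left _ _).trans (le_max_left _ _), ?_, hu.le⟩
  rw [← coe_toReal_of_mem_effDom hz, EReal.coe_le_coe_iff]
  exact (le_max_right _ _).trans (le_max_left _ _)

end Qualification

/-! ### The two inclusions. -/

section SumRule

variable {X Y : Type*} [NormedAddCommGroup X] [NormedSpace ℝ X]
  [NormedAddCommGroup Y] [NormedSpace ℝ Y] {f : X → EReal} {g : Y → EReal}

lemma mem_subdifferential_add_comp_iff (hf : ∀ x, f x ≠ ⊥) (hg : ∀ y, g y ≠ ⊥) (T : X →L[ℝ] Y)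
    {x : X} {x' : StrongDual ℝ X} :
    x' ∈ subdifferential (fun z => f z + g (T z)) x ↔ (x ∈ effDom f ∧ T x ∈ effDom g) ∧
      ∀ z ∈ effDom f, T z ∈ effDom g →
        x' (z - x) ≤ ((f z).toReal + (g (T z)).toReal) - ((f x).toReal + (g (T x)).toReal) := by
  have hdom : ∀ z, z ∈ effDom (fun z => f z + g (T z)) ↔ z ∈ effDom f ∧ T z ∈ effDom g := by
    intro z
    rw [effDom_add hf fun z => hg (T z)]
    rfl
  have hval : ∀ z, z ∈ effDom f ∧ T z ∈ effDom g →
      (f z + g (T z)).toReal = (f z).toReal + (g (T z)).toReal := by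
    rintro z ⟨h1, h2⟩
    rw [mem_effDom_iff] at h1 h2
    exact EReal.toReal_add h1.2 h1.1 h2.2 h2.1
  rw [mem_subdifferential_iff fun z => by simp [EReal.add_eq_bot_iff, hf, hg], hdom]
  refine and_congr_right fun hx => forall_congr' fun z => ?_
  rw [hdom, and_imp, hval x hx]
  refine forall_congr' fun h1 => forall_congr' fun h2 => ?_
  rw [hval z ⟨h1, h2⟩]

theorem subdifferential_add_image_subset (hf : ∀ x, f x ≠ ⊥) (hg : ∀ y, g y ≠ ⊥) (T : X →L[ℝ] Y)
    (x : X) : subdifferential f x + dualAdjoint T '' subdifferential g (T x) ⊆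
      subdifferential (fun z => f z + g (T z)) x := by
  rintro _ ⟨x', hx', _, ⟨y', hy', rfl⟩, rfl⟩
  rw [mem_subdifferential_iff hf] at hx'
  rw [mem_subdifferential_iff hg] at hy'
  refine (mem_subdifferential_add_comp_iff hf hg T).2 ⟨⟨hx'.1, hy'.1⟩, fun z hz hTz => ?_⟩
  have h1 := hx'.2 z hz
  have h2 := hy'.2 (T z) hTz
  rw [← map_sub] at h2
  change x' (z - x) + y' (T (z - x)) ≤ _
  linarith

theorem subdifferential_add_comp_subset (hf : IsConvexFun f) (hg : IsConvexFun g)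
    (T : X →L[ℝ] Y) {M : ℝ}
    (hM : ∀ᶠ u in 𝓝 (0 : Y), ∃ z y, y - T z = u ∧ ‖z‖ ≤ M ∧ f z ≤ M ∧ g y ≤ M) (x : X) :
    subdifferential (fun z => f z + g (T z)) x ⊆
      subdifferential f x + dualAdjoint T '' subdifferential g (T x) := by
  intro x' hx'
  obtain ⟨⟨hx, hTx⟩, hle⟩ := (mem_subdifferential_add_comp_iff hf.ne_bot hg.ne_bot T).1 hx'
  -- This constant makes the perturbed sum vanish at `x`, its minimum.
  set c : ℝ := x' x - (f x).toReal - (g (T x)).toReal with hc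
  have hφ : ConvexOn ℝ (effDom f) fun z => (f z).toReal + ((-x') z + c) :=
    hf.convexOn_toReal.add (((-x' : StrongDual ℝ X).toLinearMap.convexOn
      hf.convexOn_toReal.1).add_const c)
  suffices h : ∃ y' : StrongDual ℝ Y, ∀ z ∈ effDom f, ∀ y ∈ effDom g,
      y' (y - (T : X →ₗ[ℝ] Y) z) ≤ (f z).toReal + ((-x') z + c) + (g y).toReal by
    obtain ⟨y', hy'⟩ := h
    simp only [neg_apply, ContinuousLinearMap.coe_coe] at hy'
    refine ⟨x' - dualAdjoint T y', ?_, _, ⟨y', ?_, rfl⟩, sub_add_cancel _ _⟩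
    · refine (mem_subdifferential_iff hf.ne_bot).2 ⟨hx, fun z hz => ?_⟩
      -- Freezing `y = T x` isolates `f`; freezing `z = x` below isolates `g`.
      have h := hy' z hz (T x) hTx
      change x' (z - x) - y' (T (z - x)) ≤ _
      simp only [map_sub] at h ⊢
      linarith
    · refine (mem_subdifferential_iff hg.ne_bot).2 ⟨hTx, fun y hy => ?_⟩
      have h := hy' x hx y hy
      linarith
  refine exists_dual_le_of_bounded_value hφ hg.convexOn_toReal (T : X →ₗ[ℝ] Y)
    (M := M + (‖x'‖ * M + c) + M) ?_ ?_
  · intro z hz hTz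
    have h := hle z hz hTz
    simp only [map_sub, neg_apply, ContinuousLinearMap.coe_coe] at h ⊢
    linarith
  · filter_upwards [hM] with u hu
    obtain ⟨z, y, hzy, hz, hfz, hgy⟩ := hu
    rw [le_coe_iff_mem_effDom_and_toReal_le (hf.ne_bot z)] at hfz
    rw [le_coe_iff_mem_effDom_and_toReal_le (hg.ne_bot y)] at hgy
    refine ⟨z, hfz.1, y, hgy.1, hzy, ?_⟩
    -- The bound on `‖z‖` serves to control the linear perturbation.
    have h : (-x') z ≤ ‖x'‖ * M :=
      (le_abs_self _).trans (((-x').le_opNorm z).trans (by rw [norm_neg]; gcongr))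
    linarith [hfz.2, hgy.2]

end SumRule

theorem theorem2p19 {X Y : Type*}
    [NormedAddCommGroup X] [NormedSpace ℝ X] [CompleteSpace X]
    [NormedAddCommGroup Y] [NormedSpace ℝ Y] [CompleteSpace Y]
    (f : X → EReal) (g : Y → EReal) (hf : IsConvexFun f) (hg : IsConvexFun g)
    (T : X →L[ℝ] Y) :
    (∀ x : X, subdifferential f x + dualAdjoint T '' subdifferential g (T x) ⊆
      subdifferential (fun z => f z + g (T z)) x) ∧
    (FenchelCoreCondition f g T ∨ FenchelContinuityCondition f g T →
      ∀ x : X, subdifferential (fun z => f z + g (T z)) x =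
        subdifferential f x + dualAdjoint T '' subdifferential g (T x)) := by
  have hsub := subdifferential_add_image_subset hf.ne_bot hg.ne_bot T
  refine ⟨hsub, fun hq x => (Subset.antisymm ?_ (hsub x))⟩
  obtain ⟨M, hM⟩ := hq.elim (fun h => h.exists_bound hf hg) fun h => h.exists_bound
  exact subdifferential_add_comp_subset hf hg T hM x
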